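/- For an integer $n\ge 1$ and a real $\beta\ge 0$ let $$Z_{n,\beta}:=\int_{\mathbb{R}^n}\exp\Big(-\frac12\sum_{i=1}^n\lambda_i^2\Big)\prod_{1\le i<j\le n}|\lambda_j-\lambda_i|^{\beta}\,\mathrm{d}\lambda_1\cdots\mathrm{d}\lambda_n$$ be the partition function of the Gaussian $\beta$-ensemble. For real sequences $u=(u_n)$, $v=(v_n)$ write $u\ll v$ (equivalently $v\gg u$) if $u_n/v_n\to 0$ as $n\to\infty$. Let $\beta=(\beta_n)$ and $\beta'=(\beta'_n)$ be real sequences with $\beta_n\ge 0$ and $\beta'_n>0$ for all $n$. 1. If $\beta\ll\beta'\ll \frac1{n^2}$, then $\dfrac{Z_{n,\beta'_n}}{Z_{n,\beta_n}}\to 1$ as $n\to\infty$. 2. If $\beta\ll\beta'\ll\frac1n$ and $\beta'\gg\frac1{n^2}$, then $Z_{n,\beta'_n}\ll Z_{n,\beta_n}$. -/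

import Mathlib

open Filter Topology MeasureTheory

/-- The unnormalized density of the Gaussian `β`-ensemble on `ℝⁿ`:
`exp (-(1/2) ∑ᵢ λᵢ²) * ∏_{i < j} |λⱼ - λᵢ| ^ β`. -/
noncomputable def gaussianBetaWeight (n : ℕ) (β : ℝ) (x : Fin n → ℝ) : ℝ :=
  Real.exp (-(1 / 2) * ∑ i, x i ^ 2) * ∏ i : Fin n, ∏ j ∈ Finset.Ioi i, |x j - x i| ^ β

/-- The partition function `Z_{n,β}`: the integral of the weight over `ℝⁿ` with respect to
Lebesgue measure. -/
noncomputable def partitionFunction (n : ℕ) (β : ℝ) : ℝ :=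
  ∫ x : Fin n → ℝ, gaussianBetaWeight n β x

/-- `u ≪ v`: the ratio `u n / v n` tends to `0` as `n → ∞`. -/
def MuchLess (u v : ℕ → ℝ) : Prop :=
  Tendsto (fun n => u n / v n) atTop (𝓝 0)

theorem gaussianBetaWeight_nonneg (n : ℕ) (β : ℝ) (x : Fin n → ℝ) :
    0 ≤ gaussianBetaWeight n β x := by
  unfold gaussianBetaWeight
  exact mul_nonneg (Real.exp_pos _).le (Finset.prod_nonneg fun i _ =>
    Finset.prod_nonneg fun j _ => Real.rpow_nonneg (abs_nonneg _) _)

theorem continuous_gaussianBetaWeight (n : ℕ) {β : ℝ} (hβ : 0 ≤ β) :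
    Continuous (gaussianBetaWeight n β) := by
  unfold gaussianBetaWeight
  refine Continuous.mul (by fun_prop) ?_
  refine continuous_finsetProd _ fun i _ => continuous_finsetProd _ fun j _ => ?_
  exact Continuous.rpow_const (by fun_prop) fun _ => Or.inr hβ

/-- The integral defining `Z_{n,β}` converges for every `β ≥ 0`. -/
theorem integrable_gaussianBetaWeight (n : ℕ) {β : ℝ} (hβ : 0 ≤ β) :
    Integrable (gaussianBetaWeight n β) := by
  set C : ℝ := 2 * β * ∑ i : Fin n, ((Finset.Ioi i).card : ℝ) with hC
  have h1 : Integrable (fun t : ℝ => Real.exp (C ^ 2) * Real.exp (-(1 / 4) * t ^ 2)) :=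
    (integrable_exp_neg_mul_sq (by norm_num)).const_mul _
  have h2 : Integrable (fun x : Fin n → ℝ =>
      ∏ i, (Real.exp (C ^ 2) * Real.exp (-(1 / 4) * x i ^ 2))) :=
    Integrable.fintype_prod (fun _ => h1)
  refine h2.mono' (continuous_gaussianBetaWeight n hβ).aestronglyMeasurable
    (Eventually.of_forall fun x => ?_)
  rw [Real.norm_of_nonneg (gaussianBetaWeight_nonneg n β x)]
  have h3 : ∀ i j : Fin n, |x j - x i| ^ β ≤ Real.exp (2 * β * ∑ k, |x k|) := by
    intro i j
    have hk : ∀ k, |x k| ≤ ∑ k, |x k| := fun k =>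
      Finset.single_le_sum (f := fun k => |x k|) (fun _ _ => abs_nonneg _) (Finset.mem_univ k)
    have ha : |x j - x i| ≤ Real.exp (2 * ∑ k, |x k|) := by
      have := abs_sub (x j) (x i)
      have := Real.add_one_le_exp (2 * ∑ k, |x k|)
      linarith [hk i, hk j]
    calc |x j - x i| ^ β ≤ Real.exp (2 * ∑ k, |x k|) ^ β :=
          Real.rpow_le_rpow (abs_nonneg _) ha hβ
      _ = Real.exp (2 * β * ∑ k, |x k|) := by
          rw [← Real.exp_mul]; ring_nf
  have h4 : ∏ i : Fin n, ∏ j ∈ Finset.Ioi i, |x j - x i| ^ β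
      ≤ Real.exp (C * ∑ k, |x k|) := by
    calc ∏ i : Fin n, ∏ j ∈ Finset.Ioi i, |x j - x i| ^ β
        ≤ ∏ i : Fin n, ∏ _j ∈ Finset.Ioi i, Real.exp (2 * β * ∑ k, |x k|) :=
          Finset.prod_le_prod
            (fun i _ => Finset.prod_nonneg fun j _ => Real.rpow_nonneg (abs_nonneg _) _)
            (fun i _ => Finset.prod_le_prod (fun j _ => Real.rpow_nonneg (abs_nonneg _) _)
              (fun j _ => h3 i j))
      _ = Real.exp (C * ∑ k, |x k|) := by
          simp only [← Real.exp_sum, Finset.sum_const, nsmul_eq_mul]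
          rw [← Finset.sum_mul, hC]
          ring_nf
  unfold gaussianBetaWeight
  refine (mul_le_mul_of_nonneg_left h4 (Real.exp_pos _).le).trans ?_
  simp only [← Real.exp_add, ← Real.exp_sum]
  rw [Real.exp_le_exp, Finset.mul_sum, Finset.mul_sum, ← Finset.sum_add_distrib]
  refine Finset.sum_le_sum fun i _ => ?_
  nlinarith [sq_nonneg (|x i| / 2 - C), sq_abs (x i)]

theorem partitionFunction_pos (n : ℕ) {β : ℝ} (hβ : 0 ≤ β) : 0 < partitionFunction n β := by
  refine integral_pos_of_integrable_nonneg_nonzero (continuous_gaussianBetaWeight n hβ)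
    (integrable_gaussianBetaWeight n hβ) (gaussianBetaWeight_nonneg n β)
    (x := fun i => (i : ℝ)) (ne_of_gt ?_)
  unfold gaussianBetaWeight
  refine mul_pos (Real.exp_pos _) (Finset.prod_pos fun i _ => Finset.prod_pos fun j hj => ?_)
  refine Real.rpow_pos_of_pos (abs_pos.mpr (sub_ne_zero.mpr ?_)) _
  have : i < j := Finset.mem_Ioi.mp hj
  have h' : (i : ℕ) < (j : ℕ) := this
  exact Nat.cast_injective.ne h'.ne'

/-! Up to the factor `√(2π)^n`, the partition function is the `β`-th moment of the absolute
Vandermonde determinant of independent standard Gaussians. The edges of the complete graph on `n`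
vertices split into `n` matchings, and along a matching the differences are independent with law
N(0, 2). Hölder with weights `1/n` (`vandermondeMoment_le`) therefore bounds the moment by
`G(nβ)^((n-1)/2)`, where `G(s) = E|N(0,2)|^s`. Since `log G` has slope `-γ/2 < 0` at `0`, `G(s)` and
`G(-s)` are at most exponentials linear in `s` for small `s` (`exists_gaussian_moment_bounds`).

The Hölder bound also holds for negative exponents. Cauchy–Schwarz for the determinant and its
reciprocal (`one_le_vandermondeMoment_mul_neg`) turns it into a lower bound. Hence, for `nβ` small,
`log (Z_{n,β} / Z_{n,0})` lies between two negative multiples of `n(n-1)β`, which tends to `0` or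
dominates according to the size of `n²β'`. -/

open ProbabilityTheory
open scoped ENNReal NNReal

/-! ### The partition function as a Gaussian moment -/

/-- The law of `n` independent standard Gaussian variables. -/
noncomputable def stdGaussianPi (n : ℕ) : Measure (Fin n → ℝ) :=
  Measure.pi fun _ => gaussianReal 0 1

instance (n : ℕ) : IsProbabilityMeasure (stdGaussianPi n) := by
  unfold stdGaussianPi; infer_instance

/-- A product measure is determined by its values on boxes, and there Fubini factors the integral of
the product density. -/
theorem pi_withDensity_ofReal {ι : Type*} [Fintype ι] {ν : Measure ℝ} [SigmaFinite ν]
    {f : ℝ → ℝ} (hf0 : ∀ t, 0 ≤ f t) (hf : Integrable f ν) :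
    Measure.pi (fun _ : ι => ν.withDensity fun t => ENNReal.ofReal (f t)) =
      (Measure.pi fun _ : ι => ν).withDensity fun x => ENNReal.ofReal (∏ i, f (x i)) := by
  have : IsFiniteMeasure (ν.withDensity fun t => ENNReal.ofReal (f t)) :=
    isFiniteMeasure_withDensity_ofReal hf.2
  refine Measure.pi_eq fun s hs => ?_
  rw [withDensity_apply _ (MeasurableSet.univ_pi hs), Measure.restrict_pi_pi,
    ← ofReal_integral_eq_lintegral_ofReal (Integrable.fintype_prod fun i => hf.restrict)
      (Eventually.of_forall fun x => Finset.prod_nonneg fun i _ => hf0 _),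
    integral_fintype_prod_eq_prod (fun _ => f),
    ENNReal.ofReal_prod_of_nonneg fun i _ => integral_nonneg hf0]
  refine Finset.prod_congr rfl fun i _ => ?_
  rw [withDensity_apply _ (hs i), ofReal_integral_eq_lintegral_ofReal hf.restrict
    (Eventually.of_forall hf0)]

theorem stdGaussianPi_eq_withDensity (n : ℕ) :
    stdGaussianPi n = (volume : Measure (Fin n → ℝ)).withDensity
      fun x => ENNReal.ofReal (∏ i, gaussianPDFReal 0 1 (x i)) := by
  rw [stdGaussianPi, gaussianReal_of_var_ne_zero _ one_ne_zero]
  exact pi_withDensity_ofReal (gaussianPDFReal_nonneg 0 1) (integrable_gaussianPDFReal 0 1)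

/-- The `β`-th moment of the absolute Vandermonde determinant of `n` independent standard
Gaussian variables. -/
noncomputable def vandermondeMoment (n : ℕ) (β : ℝ) : ℝ≥0∞ :=
  ∫⁻ x, ∏ i : Fin n, ∏ j ∈ Finset.Ioi i, ENNReal.ofReal (|x j - x i| ^ β) ∂stdGaussianPi n

theorem ofReal_partitionFunction (n : ℕ) {β : ℝ} (hβ : 0 ≤ β) :
    ENNReal.ofReal (partitionFunction n β) =
      ENNReal.ofReal (√(2 * Real.pi) ^ n) * vandermondeMoment n β := by
  rw [partitionFunction, ofReal_integral_eq_lintegral_ofReal (integrable_gaussianBetaWeight n hβ)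
    (Eventually.of_forall (gaussianBetaWeight_nonneg n β)), vandermondeMoment,
    stdGaussianPi_eq_withDensity, lintegral_withDensity_eq_lintegral_mul _ (by fun_prop)
      (by fun_prop), ← lintegral_const_mul' _ _ ENNReal.ofReal_ne_top]
  refine lintegral_congr fun x => ?_
  have h0 : 0 < √(2 * Real.pi) := by positivity
  have h1 : ∀ i : Fin n, 0 ≤ ∏ j ∈ Finset.Ioi i, |x j - x i| ^ β := fun i =>
    Finset.prod_nonneg fun j _ => Real.rpow_nonneg (abs_nonneg _) _
  have h2 : ∏ i : Fin n, ∏ j ∈ Finset.Ioi i, ENNReal.ofReal (|x j - x i| ^ β) =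
      ENNReal.ofReal (∏ i : Fin n, ∏ j ∈ Finset.Ioi i, |x j - x i| ^ β) := by
    rw [ENNReal.ofReal_prod_of_nonneg fun i _ => h1 i]
    refine Finset.prod_congr rfl fun i _ => ?_
    rw [ENNReal.ofReal_prod_of_nonneg fun j _ => Real.rpow_nonneg (abs_nonneg _) _]
  have h3 : ∏ i, gaussianPDFReal 0 1 (x i) =
      (√(2 * Real.pi) ^ n)⁻¹ * Real.exp (-(1 / 2) * ∑ i, x i ^ 2) := by
    simp only [gaussianPDFReal, Finset.prod_mul_distrib, ← Real.exp_sum, Finset.mul_sum,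
      Finset.prod_const, Finset.card_univ, Fintype.card_fin, NNReal.coe_one, mul_one, sub_zero,
      inv_pow]
    congr 2
    exact Finset.sum_congr rfl fun i _ => by ring
  rw [Pi.mul_apply, h2, h3, ← ENNReal.ofReal_mul (by positivity),
    ← ENNReal.ofReal_mul (by positivity), gaussianBetaWeight]
  congr 1
  field_simp

/-! ### Differences along a matching -/

theorem map_sub_stdGaussianPi {n : ℕ} {i j : Fin n} (hij : i ≠ j) :
    (stdGaussianPi n).map (fun x => x j - x i) = gaussianReal 0 2 := by
  have hind : iIndepFun (fun (i : Fin n) (x : Fin n → ℝ) => x i) (stdGaussianPi n) :=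
    iIndepFun_pi (X := fun _ => id) fun _ => aemeasurable_id
  have hm : ∀ i : Fin n, (stdGaussianPi n).map (fun x => x i) = gaussianReal 0 1 := fun i =>
    (measurePreserving_eval (fun _ : Fin n => gaussianReal 0 1) i).map_eq
  have hneg : (stdGaussianPi n).map (fun x => -x i) = gaussianReal 0 1 := by
    have h := gaussianReal_map_neg (μ := 0) (v := 1)
    rw [← hm i, Measure.map_map (by fun_prop) (by fun_prop), neg_zero] at h
    exact h
  have h := gaussianReal_add_gaussianReal_of_indepFun
    ((hind.indepFun hij.symm).comp measurable_id measurable_neg) (hm j) hneg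
  rw [add_zero, one_add_one_eq_two] at h
  rw [← h]
  congr 1

/-- Differences along the edges of a matching are independent. -/
theorem lintegral_prod_sub_of_matching {n : ℕ} {h : ℝ → ℝ≥0∞} (hh : Measurable h)
    (M : Finset (Fin n × Fin n)) (hne : ∀ p ∈ M, p.1 ≠ p.2)
    (hM : ∀ p ∈ M, ∀ q ∈ M, p ≠ q →
      p.1 ≠ q.1 ∧ p.1 ≠ q.2 ∧ p.2 ≠ q.1 ∧ p.2 ≠ q.2) :
    ∫⁻ x, ∏ p ∈ M, h (x p.2 - x p.1) ∂stdGaussianPi n =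
      (∫⁻ t, h t ∂gaussianReal 0 2) ^ M.card := by
  have hind : iIndepFun (fun (i : Fin n) (x : Fin n → ℝ) => x i) (stdGaussianPi n) :=
    iIndepFun_pi (X := fun _ => id) fun _ => aemeasurable_id
  induction M using Finset.induction_on with
  | empty => simp
  | insert p M hp ih =>
    -- The new edge shares no vertex with the remaining ones, so its factor and their product depend
    -- on disjoint blocks of coordinates.
    have hdisj : Disjoint ({p.1, p.2} : Finset (Fin n)) (M.biUnion fun q => {q.1, q.2}) := by
      rw [Finset.disjoint_biUnion_right]
      intro q hq
      have := hM p (Finset.mem_insert_self _ _) q (Finset.mem_insert_of_mem hq)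
        (by rintro rfl; exact hp hq)
      simp only [Finset.disjoint_insert_left, Finset.disjoint_singleton_left, Finset.mem_insert,
        Finset.mem_singleton]
      tauto
    have hI := hind.indepFun_finset _ _ hdisj fun i => measurable_pi_apply i
    have hmem : ∀ q ∈ M, q.1 ∈ (M.biUnion fun q => {q.1, q.2}) ∧
        q.2 ∈ (M.biUnion fun q => {q.1, q.2}) := fun q hq =>
      ⟨Finset.mem_biUnion.2 ⟨q, hq, by simp⟩, Finset.mem_biUnion.2 ⟨q, hq, by simp⟩⟩
    have hI' : IndepFun (fun x : Fin n → ℝ => h (x p.2 - x p.1))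
        (fun x => ∏ q ∈ M, h (x q.2 - x q.1)) (stdGaussianPi n) := by
      have := hI.comp
        (φ := fun y : ({p.1, p.2} : Finset (Fin n)) → ℝ =>
          h (y ⟨p.2, by simp⟩ - y ⟨p.1, by simp⟩))
        (ψ := fun y : (M.biUnion fun q => ({q.1, q.2} : Finset (Fin n))) → ℝ =>
          ∏ q ∈ M.attach, h (y ⟨q.1.2, (hmem q.1 q.2).2⟩ - y ⟨q.1.1, (hmem q.1 q.2).1⟩))
        (by fun_prop) (by fun_prop)
      refine this.congr (.of_forall fun _ => rfl) (.of_forall fun x => ?_)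
      exact Finset.prod_attach M fun q => h (x q.2 - x q.1)
    simp only [Finset.prod_insert hp, Finset.card_insert_of_notMem hp]
    rw [lintegral_mul_eq_lintegral_mul_lintegral_of_indepFun'' (by fun_prop) (by fun_prop) hI',
      ih (fun q hq => hne q (Finset.mem_insert_of_mem hq)) (fun q hq r hr =>
        hM q (Finset.mem_insert_of_mem hq) r (Finset.mem_insert_of_mem hr)),
      ← map_sub_stdGaussianPi (hne p (Finset.mem_insert_self _ _)),
      lintegral_map hh (by fun_prop), pow_succ, mul_comm]

/-! ### Absolute moments of a single difference -/

theorem rpow_gaussian_moment {s : ℝ} (hs : -1 < s) :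
    ∫⁻ t, ENNReal.ofReal (|t| ^ s) ∂gaussianReal 0 2 =
      ENNReal.ofReal ((√Real.pi)⁻¹ * (2 ^ s * Real.Gamma ((s + 1) / 2))) := by
  have hpdf : ∀ t, gaussianPDFReal 0 2 t = (2 * √Real.pi)⁻¹ * Real.exp (-(1 / 4) * t ^ 2) := by
    intro t
    rw [gaussianPDFReal]
    have : √(2 * Real.pi * ((2 : ℝ≥0) : ℝ)) = 2 * √Real.pi := by
      rw [show 2 * Real.pi * ((2 : ℝ≥0) : ℝ) = 2 ^ 2 * Real.pi by push_cast; ring,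
        Real.sqrt_mul (by norm_num), Real.sqrt_sq (by norm_num)]
    rw [this]
    congr 2
    push_cast
    ring
  have hpos : Real.pi.sqrt ≠ 0 := by positivity
  set F : ℝ → ℝ := fun t => t ^ s * Real.exp (-(1 / 4) * t ^ (2 : ℝ)) with hF
  have hint : ∫ t in Set.Ioi 0, F t = 2 ^ s * Real.Gamma ((s + 1) / 2) := by
    rw [hF, integral_rpow_mul_exp_neg_mul_rpow two_pos hs (by norm_num)]
    have : (1 / 4 : ℝ) ^ (-(s + 1) / 2) = 2 ^ s * 2 := by
      rw [show (1 / 4 : ℝ) = 2 ^ (-2 : ℝ) by rw [Real.rpow_neg (by norm_num)]; norm_num,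
        ← Real.rpow_mul (by norm_num), show -2 * (-(s + 1) / 2) = s + 1 by ring,
        Real.rpow_add (by norm_num), Real.rpow_one]
    rw [this]
    ring
  have hFabs : Integrable fun t => F |t| := by
    -- A non-integrable function has integral `0` by convention, so the nonzero value of the
    -- integral already proves integrability.
    refine not_imp_comm.1 integral_undef ?_
    rw [integral_comp_abs, hint]
    have := Real.Gamma_pos_of_pos (show 0 < (s + 1) / 2 by linarith)
    positivity
  rw [gaussianReal_of_var_ne_zero _ two_ne_zero,
    lintegral_withDensity_eq_lintegral_mul _ (measurable_gaussianPDF _ _) (by fun_prop)]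
  calc _ = ∫⁻ t, ENNReal.ofReal ((2 * √Real.pi)⁻¹ * F |t|) := by
        refine lintegral_congr fun t => ?_
        rw [Pi.mul_apply, gaussianPDF, ← ENNReal.ofReal_mul (gaussianPDFReal_nonneg _ _ _), hpdf]
        congr 1
        simp only [hF, Real.rpow_two, sq_abs]
        ring
    _ = _ := by
        rw [← ofReal_integral_eq_lintegral_ofReal (hFabs.const_mul _)
          (Eventually.of_forall fun t => by simp only [hF]; positivity), integral_const_mul,
          integral_comp_abs, hint]
        congr 1
        field_simp

/-! ### Hölder's inequality over an edge colouring -/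

theorem card_filter_fst_lt_snd (n : ℕ) :
    (((Finset.univ : Finset (Fin n × Fin n)).filter fun p => p.1 < p.2).card : ℝ) =
      n * (n - 1) / 2 := by
  have h : ((Finset.univ : Finset (Fin n × Fin n)).filter fun p => p.1 < p.2).card * 2 =
      n * (n - 1) := by
    rw [Finset.card_eq_sum_ones, Finset.sum_finset_product _ Finset.univ (fun i => Finset.Ioi i)
      (by simp)]
    simp only [Finset.sum_const, smul_eq_mul, mul_one, Fin.card_Ioi]
    rw [Fin.sum_univ_eq_sum_range (fun i => n - 1 - i), Finset.sum_range_reflect (fun i => i),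
      Finset.sum_range_id_mul_two]
  rcases n with _ | n
  · simp
  · rw [eq_div_iff two_ne_zero]
    have := congrArg (Nat.cast : ℕ → ℝ) h
    push_cast [Nat.add_sub_cancel] at this ⊢
    linarith

/-- Hölder's inequality over a decomposition of the complete graph into `n` matchings. -/
theorem vandermondeMoment_le {n : ℕ} (hn : n ≠ 0) (β : ℝ) :
    vandermondeMoment n β ≤
      (∫⁻ t, ENNReal.ofReal (|t| ^ (n * β)) ∂gaussianReal 0 2) ^ (((n : ℝ) - 1) / 2) := by
  have : NeZero n := ⟨hn⟩
  have hn' : (n : ℝ) ≠ 0 := by exact_mod_cast hn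
  set G := ∫⁻ t, ENNReal.ofReal (|t| ^ (n * β)) ∂gaussianReal 0 2 with hG
  set E := (Finset.univ : Finset (Fin n × Fin n)).filter fun p => p.1 < p.2 with hE
  -- Addition in `Fin n` is modulo `n`: the colour and one endpoint determine the other endpoint, so
  -- each colour class is a matching, whatever the parity of `n`.
  set color : Fin n × Fin n → Fin n := fun p => p.1 + p.2 with hcolor
  have hmatch : ∀ c, ∫⁻ x, ∏ p ∈ E with color p = c,
      ENNReal.ofReal (|x p.2 - x p.1| ^ (n * β)) ∂stdGaussianPi n =
        G ^ (E.filter fun p => color p = c).card := by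
    intro c
    refine lintegral_prod_sub_of_matching (h := fun t => ENNReal.ofReal (|t| ^ (n * β)))
      (by fun_prop) _ ?_ ?_
    · intro p hp
      simp only [hE, Finset.mem_filter, Finset.mem_univ, true_and] at hp
      exact hp.1.ne
    · rintro ⟨p, p'⟩ hp ⟨q, q'⟩ hq hpq
      simp only [hE, hcolor, Finset.mem_filter, Finset.mem_univ, true_and] at hp hq
      have hs : p + p' = q + q' := hp.2.trans hq.2.symm
      refine ⟨?_, ?_, ?_, ?_⟩
      · rintro rfl
        exact hpq (by rw [add_left_cancel hs])
      -- In the two crossed cases, equal colours force the edges to be reversals of each other,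
      -- contradicting the orientation `p.1 < p.2`.
      · rintro rfl
        rw [add_comm q] at hs
        have h' : p' = q := add_left_cancel hs
        exact absurd (hp.1.trans (h' ▸ hq.1)) (lt_irrefl _)
      · rintro rfl
        rw [add_comm p] at hs
        have h' : p = q' := add_left_cancel hs
        exact absurd (hp.1.trans (h' ▸ hq.1)) (lt_irrefl _)
      · rintro rfl
        exact hpq (by rw [add_right_cancel hs])
  have hpt : ∀ x : Fin n → ℝ,
      ∏ i : Fin n, ∏ j ∈ Finset.Ioi i, ENNReal.ofReal (|x j - x i| ^ β) =
        ∏ c : Fin n, (∏ p ∈ E with color p = c,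
          ENNReal.ofReal (|x p.2 - x p.1| ^ (n * β))) ^ (1 / (n : ℝ)) := by
    intro x
    rw [← Finset.prod_finset_product E Finset.univ (fun i => Finset.Ioi i) (by simp [hE])
      (f := fun p => ENNReal.ofReal (|x p.2 - x p.1| ^ β)), ← Finset.prod_fiberwise E color]
    refine Finset.prod_congr rfl fun c _ => ?_
    rw [← ENNReal.prod_rpow_of_nonneg (by positivity)]
    refine Finset.prod_congr rfl fun p _ => ?_
    rw [ENNReal.ofReal_rpow_of_nonneg (by positivity) (by positivity),
      ← Real.rpow_mul (abs_nonneg _)]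
    congr 2
    field_simp
  calc vandermondeMoment n β
      = ∫⁻ x, ∏ c : Fin n, (∏ p ∈ E with color p = c,
          ENNReal.ofReal (|x p.2 - x p.1| ^ (n * β))) ^ (1 / (n : ℝ)) ∂stdGaussianPi n :=
        lintegral_congr hpt
    _ ≤ ∏ c : Fin n, (∫⁻ x, ∏ p ∈ E with color p = c,
          ENNReal.ofReal (|x p.2 - x p.1| ^ (n * β)) ∂stdGaussianPi n) ^ (1 / (n : ℝ)) :=
        ENNReal.lintegral_prod_norm_pow_le _ (fun c _ => by fun_prop)
          (by simp [hn']) (fun _ _ => by positivity)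
    _ = G ^ (((n : ℝ) - 1) / 2) := by
        simp only [hmatch]
        rw [ENNReal.prod_rpow_of_nonneg (by positivity), Finset.prod_pow_eq_pow_sum,
          -- The class sizes add up to `n(n-1)/2`; the Hölder weight `1/n` leaves the exponent
          -- `(n-1)/2`.
          ← Finset.card_eq_sum_card_fiberwise (fun _ _ => Finset.mem_coe.2 (Finset.mem_univ _)),
          ← ENNReal.rpow_natCast, ← ENNReal.rpow_mul, card_filter_fst_lt_snd]
        congr 1
        field_simp

/-! ### Moments with exponent near zero -/

/-- The factor `2 ^ s` contributes `log 2` and the Gamma factor `-(γ + 2 log 2) / 2`, so the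
logarithms cancel. -/
theorem hasDerivAt_log_gaussian_moment :
    HasDerivAt (fun s : ℝ => Real.log ((√Real.pi)⁻¹ * (2 ^ s * Real.Gamma ((s + 1) / 2))))
      (-(Real.eulerMascheroniConstant / 2)) 0 := by
  have hpos : √Real.pi ≠ 0 := by positivity
  have h1 : HasDerivAt (fun s : ℝ => Real.Gamma ((s + 1) / 2))
      (-√Real.pi * (Real.eulerMascheroniConstant + 2 * Real.log 2) * (1 / 2)) 0 := by
    refine HasDerivAt.comp (0 : ℝ) (h₂ := Real.Gamma) (h := fun s : ℝ => (s + 1) / 2) ?_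
      (((hasDerivAt_id (0 : ℝ)).add_const 1).div_const 2)
    simpa using Real.hasDerivAt_Gamma_one_half
  have h2 : HasDerivAt (fun s : ℝ => (2 : ℝ) ^ s) (Real.log 2) 0 := by
    simpa using (hasDerivAt_id (0 : ℝ)).const_rpow (a := 2) two_pos
  have h0 : Real.Gamma ((0 + 1) / 2) = √Real.pi := by rw [zero_add, Real.Gamma_one_half_eq]
  have h3 := ((h2.mul h1).const_mul (√Real.pi)⁻¹).log
    (by simp only [Pi.mul_apply, h0]; simp [hpos])
  refine h3.congr_deriv ?_
  simp only [Pi.mul_apply, h0, Real.rpow_zero]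
  field_simp
  ring

theorem exists_gaussian_moment_bounds : ∃ δ : ℝ, 0 < δ ∧ ∀ s, 0 ≤ s → s ≤ δ →
    ∫⁻ t, ENNReal.ofReal (|t| ^ s) ∂gaussianReal 0 2 ≤ ENNReal.ofReal (Real.exp (-(s / 8))) ∧
    ∫⁻ t, ENNReal.ofReal (|t| ^ (-s)) ∂gaussianReal 0 2 ≤ ENNReal.ofReal (Real.exp s) := by
  have h := (hasDerivAt_iff_isLittleO.1 hasDerivAt_log_gaussian_moment).def
    (show (0 : ℝ) < 1 / 8 by norm_num)
  obtain ⟨ε, hε, hb⟩ := Metric.eventually_nhds_iff.1 h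
  have hbound : ∀ s : ℝ, |s| < ε → |s| < 1 →
      ∫⁻ t, ENNReal.ofReal (|t| ^ s) ∂gaussianReal 0 2 ≤
        ENNReal.ofReal (Real.exp (-(Real.eulerMascheroniConstant / 2) * s + 1 / 8 * |s|)) := by
    intro s hs hs1
    have hs2 := (abs_lt.1 hs1).1
    have := Real.Gamma_pos_of_pos (show 0 < (s + 1) / 2 by linarith)
    rw [rpow_gaussian_moment hs2]
    refine ENNReal.ofReal_le_ofReal ?_
    rw [← Real.log_le_iff_le_exp (by positivity)]
    have hb' := hb (y := s) (by simpa using hs)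
    have hz : Real.log ((√Real.pi)⁻¹ * (2 ^ (0 : ℝ) * Real.Gamma ((0 + 1) / 2))) = 0 := by
      have hpos : √Real.pi ≠ 0 := by positivity
      rw [zero_add, Real.Gamma_one_half_eq, Real.rpow_zero, one_mul, inv_mul_cancel₀ hpos,
        Real.log_one]
    rw [hz, sub_zero, sub_zero, smul_eq_mul, Real.norm_eq_abs, Real.norm_eq_abs] at hb'
    linarith [(abs_le.1 hb').2]
  -- With error `|s|/8`, `γ > 1/2` gives the slope `-1/4 + 1/8 = -1/8` for positive exponents, and
  -- `γ < 2/3` gives `1/3 + 1/8 < 1` for negative ones.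
  have hγ := Real.one_half_lt_eulerMascheroniConstant
  have hγ' := Real.eulerMascheroniConstant_lt_two_thirds
  refine ⟨min ε 1 / 2, by positivity, fun s hs0 hs => ?_⟩
  have hsε : |s| < ε := by
    rw [abs_of_nonneg hs0]; linarith [min_le_left ε 1]
  have hs1 : |s| < 1 := by
    rw [abs_of_nonneg hs0]; linarith [min_le_right ε 1]
  constructor
  · refine (hbound s hsε hs1).trans (ENNReal.ofReal_le_ofReal (Real.exp_le_exp.2 ?_))
    rw [abs_of_nonneg hs0]
    nlinarith
  · refine (hbound (-s) (by rwa [abs_neg]) (by rwa [abs_neg])).trans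
      (ENNReal.ofReal_le_ofReal (Real.exp_le_exp.2 ?_))
    rw [abs_neg, abs_of_nonneg hs0]
    nlinarith

/-! ### The reciprocal determinant and the lower bound -/

/-- Needed because `|t| ^ β * |t| ^ (-β) = 1` fails at `t = 0` when `β ≠ 0`: both powers are then
`0`. -/
theorem ae_ne_stdGaussianPi (n : ℕ) : ∀ᵐ x ∂stdGaussianPi n, ∀ i j, i ≠ j → x j - x i ≠ 0 := by
  refine ae_all_iff.2 fun i => ae_all_iff.2 fun j => ?_
  by_cases hij : i = j
  · simp [hij]
  have : NullSingletonClass (gaussianReal 0 2) := nullSingletonClass_gaussianReal two_ne_zero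
  have h : ∀ᵐ t ∂gaussianReal 0 2, t ≠ 0 := by
    simp [ae_iff, measure_singleton]
  rw [← map_sub_stdGaussianPi hij] at h
  filter_upwards [ae_of_ae_map (by fun_prop) h] with x hx _ using hx

/-- The Cauchy–Schwarz inequality for a function and its reciprocal. -/
theorem one_le_vandermondeMoment_mul_neg (n : ℕ) (β : ℝ) :
    1 ≤ vandermondeMoment n β * vandermondeMoment n (-β) := by
  have hmeas : ∀ b : ℝ, AEMeasurable (fun x : Fin n → ℝ =>
      ∏ i : Fin n, ∏ j ∈ Finset.Ioi i, ENNReal.ofReal (|x j - x i| ^ b)) (stdGaussianPi n) :=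
    fun b => by fun_prop
  have h := ENNReal.lintegral_mul_le_Lp_mul_Lq (stdGaussianPi n) Real.HolderConjugate.two_two
    ((hmeas β).pow_const (1 / 2 : ℝ)) ((hmeas (-β)).pow_const (1 / 2 : ℝ))
  have hone : ∫⁻ x, ((fun x : Fin n → ℝ => (∏ i : Fin n, ∏ j ∈ Finset.Ioi i,
      ENNReal.ofReal (|x j - x i| ^ β)) ^ (1 / 2 : ℝ)) * (fun x : Fin n → ℝ =>
        (∏ i : Fin n, ∏ j ∈ Finset.Ioi i, ENNReal.ofReal (|x j - x i| ^ (-β))) ^ (1 / 2 : ℝ))) x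
        ∂stdGaussianPi n = 1 := by
    rw [← measure_univ (μ := stdGaussianPi n), ← lintegral_one]
    refine lintegral_congr_ae ?_
    filter_upwards [ae_ne_stdGaussianPi n] with x hx
    rw [Pi.mul_apply, ← ENNReal.mul_rpow_of_nonneg _ _ (by norm_num), ← Finset.prod_mul_distrib]
    simp only [← Finset.prod_mul_distrib]
    rw [Finset.prod_eq_one, ENNReal.one_rpow]
    intro i _
    refine Finset.prod_eq_one fun j hj => ?_
    have hpos : 0 < |x j - x i| := abs_pos.2 (hx i j (Finset.mem_Ioi.1 hj).ne)
    rw [← ENNReal.ofReal_mul (by positivity), ← Real.rpow_add hpos, add_neg_cancel,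
      Real.rpow_zero, ENNReal.ofReal_one]
  rw [hone] at h
  have hsq : ∀ a : ℝ≥0∞, (a ^ (1 / 2 : ℝ)) ^ (2 : ℝ) = a := fun a => by
    rw [← ENNReal.rpow_mul]; norm_num
  simp only [hsq] at h
  rw [← ENNReal.mul_rpow_of_nonneg _ _ (by norm_num)] at h
  have hpow := ENNReal.rpow_le_rpow h (show (0 : ℝ) ≤ 2 by norm_num)
  rwa [hsq, ENNReal.one_rpow] at hpow

/-! ### Two-sided bounds and the limits -/

/-- For `n β` small, `Z_{n,β} / Z_{n,0}` is squeezed between exponentials of multiples of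
`-n (n - 1) β`. -/
theorem exists_partitionFunction_bounds : ∃ δ : ℝ, 0 < δ ∧ ∀ (n : ℕ) (β : ℝ), n ≠ 0 → 0 ≤ β →
    n * β ≤ δ →
    √(2 * Real.pi) ^ n * Real.exp (-(n * (n - 1) * β / 2)) ≤ partitionFunction n β ∧
    partitionFunction n β ≤ √(2 * Real.pi) ^ n * Real.exp (-(n * (n - 1) * β / 16)) := by
  obtain ⟨δ, hδ, h⟩ := exists_gaussian_moment_bounds
  refine ⟨δ, hδ, fun n β hn hβ hnβ => ?_⟩
  have hn1 : (0 : ℝ) ≤ ((n : ℝ) - 1) / 2 := by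
    have : (1 : ℝ) ≤ n := by exact_mod_cast Nat.one_le_iff_ne_zero.2 hn
    linarith
  obtain ⟨hpos, hneg⟩ := h (n * β) (by positivity) hnβ
  have hexp : ∀ a : ℝ, ENNReal.ofReal (Real.exp a) ^ (((n : ℝ) - 1) / 2) =
      ENNReal.ofReal (Real.exp (a * (((n : ℝ) - 1) / 2))) := fun a => by
    rw [ENNReal.ofReal_rpow_of_nonneg (Real.exp_pos _).le hn1, ← Real.exp_mul]
  have hup : vandermondeMoment n β ≤ ENNReal.ofReal (Real.exp (-(n * (n - 1) * β / 16))) := by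
    refine (vandermondeMoment_le hn β).trans ((ENNReal.rpow_le_rpow hpos hn1).trans_eq ?_)
    rw [hexp]
    ring_nf
  have hup' : vandermondeMoment n (-β) ≤ ENNReal.ofReal (Real.exp (n * (n - 1) * β / 2)) := by
    refine (vandermondeMoment_le hn (-β)).trans ?_
    rw [mul_neg]
    refine (ENNReal.rpow_le_rpow hneg hn1).trans_eq ?_
    rw [hexp]
    ring_nf
  -- The upper bound for the exponent `-β`, inserted into the Cauchy–Schwarz inequality, becomes a
  -- lower bound for the exponent `β`.
  have hlow : ENNReal.ofReal (Real.exp (-(n * (n - 1) * β / 2))) ≤ vandermondeMoment n β := by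
    have h1 := (one_le_vandermondeMoment_mul_neg n β).trans (mul_le_mul_right hup' _)
    calc ENNReal.ofReal (Real.exp (-(n * (n - 1) * β / 2)))
        ≤ ENNReal.ofReal (Real.exp (-(n * (n - 1) * β / 2))) *
          (vandermondeMoment n β * ENNReal.ofReal (Real.exp (n * (n - 1) * β / 2))) :=
          le_mul_of_one_le_right' h1
      _ = vandermondeMoment n β := by
          rw [mul_left_comm, ← ENNReal.ofReal_mul (Real.exp_pos _).le, ← Real.exp_add,
            neg_add_cancel, Real.exp_zero, ENNReal.ofReal_one, mul_one]
  have hc : (0 : ℝ) ≤ √(2 * Real.pi) ^ n := by positivity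
  constructor
  · rw [← ENNReal.ofReal_le_ofReal_iff (partitionFunction_pos n hβ).le,
      ofReal_partitionFunction n hβ, ENNReal.ofReal_mul hc]
    gcongr
  · rw [← ENNReal.ofReal_le_ofReal_iff (by positivity),
      ofReal_partitionFunction n hβ, ENNReal.ofReal_mul hc]
    gcongr

theorem exists_partitionFunction_ratio_bounds : ∃ δ : ℝ, 0 < δ ∧ ∀ (n : ℕ) (β β' : ℝ), n ≠ 0 →
    0 ≤ β → β ≤ β' → n * β' ≤ δ →
    Real.exp (-(n * (n - 1) * β' / 2)) ≤ partitionFunction n β' / partitionFunction n β ∧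
    partitionFunction n β' / partitionFunction n β ≤
      Real.exp (n * (n - 1) * β / 2 - n * (n - 1) * β' / 16) := by
  obtain ⟨δ, hδ, h⟩ := exists_partitionFunction_bounds
  refine ⟨δ, hδ, fun n β β' hn hβ hle hnβ => ?_⟩
  have hn1 : (0 : ℝ) ≤ (n : ℝ) - 1 := by
    have : (1 : ℝ) ≤ n := by exact_mod_cast Nat.one_le_iff_ne_zero.2 hn
    linarith
  obtain ⟨l, u⟩ := h n β hn hβ ((mul_le_mul_of_nonneg_left hle (by positivity)).trans hnβ)
  obtain ⟨l', u'⟩ := h n β' hn (hβ.trans hle) hnβ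
  have hc : (0 : ℝ) < √(2 * Real.pi) ^ n := by positivity
  have hZ := partitionFunction_pos n hβ
  rw [le_div_iff₀ hZ, div_le_iff₀ hZ]
  constructor
  · refine le_trans ?_ l'
    rw [mul_comm]
    gcongr
    -- For the lower bound on the ratio, the decay of the denominator is discarded.
    refine u.trans (mul_le_of_le_one_right hc.le (Real.exp_le_one_iff.2 ?_))
    have : 0 ≤ n * (n - 1) * β / 16 := by positivity
    linarith
  · refine u'.trans (le_trans (le_of_eq ?_) (mul_le_mul_of_nonneg_left l (Real.exp_pos _).le))
    rw [mul_left_comm, ← Real.exp_add]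
    ring_nf

theorem mainTheorem2 (β β' : ℕ → ℝ) (hβ : ∀ n, 0 ≤ β n) (hβ' : ∀ n, 0 < β' n)
    (hββ' : MuchLess β β') :
    (MuchLess β' (fun n => 1 / (n : ℝ) ^ 2) →
      Tendsto (fun n => partitionFunction n (β' n) / partitionFunction n (β n)) atTop (𝓝 1)) ∧
    (MuchLess β' (fun n => 1 / (n : ℝ)) → MuchLess (fun n => 1 / (n : ℝ) ^ 2) β' →
      MuchLess (fun n => partitionFunction n (β' n)) (fun n => partitionFunction n (β n))) := by
  obtain ⟨δ, hδ, h⟩ := exists_partitionFunction_ratio_bounds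
  -- With `β ≤ β'/16`, the loss `β/2` from the denominator is at most `β'/32`, half of the gain
  -- `β'/16` from the numerator.
  have hsmall : ∀ᶠ n in atTop, β n ≤ β' n / 16 := by
    filter_upwards [hββ'.eventually_le_const (show (0 : ℝ) < 1 / 16 by norm_num)] with n hn
    rw [div_le_iff₀ (hβ' n)] at hn
    linarith
  unfold MuchLess
  constructor
  · intro h2
    have h2' : Tendsto (fun n : ℕ => (n : ℝ) ^ 2 * β' n) atTop (𝓝 0) :=
      h2.congr fun n => by rw [div_div_eq_mul_div, div_one, mul_comm]
    have key : ∀ᶠ n : ℕ in atTop, Real.exp (-((n : ℝ) ^ 2 * β' n)) ≤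
        partitionFunction n (β' n) / partitionFunction n (β n) ∧
        partitionFunction n (β' n) / partitionFunction n (β n) ≤
          Real.exp ((n : ℝ) ^ 2 * β' n) := by
      filter_upwards [h2'.eventually_le_const hδ, eventually_ne_atTop 0, hsmall] with n hn hn0 hs
      have hn1 : (1 : ℝ) ≤ n := by exact_mod_cast Nat.one_le_iff_ne_zero.2 hn0
      have hb' := hβ' n
      have hle : β n ≤ β' n := by linarith
      obtain ⟨l, u⟩ := h n (β n) (β' n) hn0 (hβ n) hle
        (le_trans (mul_le_mul_of_nonneg_right (by nlinarith) hb'.le) hn)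
      have hnn : (0 : ℝ) ≤ n * (n - 1) := mul_nonneg (by linarith) (by linarith)
      have hnb : n * (n - 1) * β' n ≤ (n : ℝ) ^ 2 * β' n :=
        mul_le_mul_of_nonneg_right (by nlinarith) hb'.le
      have hnb0 : 0 ≤ n * (n - 1) * β' n := mul_nonneg hnn hb'.le
      have hnb1 : n * (n - 1) * β n ≤ n * (n - 1) * β' n := mul_le_mul_of_nonneg_left hle hnn
      exact ⟨le_trans (Real.exp_le_exp.2 (by linarith)) l,
        u.trans (Real.exp_le_exp.2 (by linarith))⟩
    have hl : Tendsto (fun n : ℕ => Real.exp (-((n : ℝ) ^ 2 * β' n))) atTop (𝓝 1) := by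
      simpa [Function.comp_def] using (Real.continuous_exp.tendsto _).comp h2'.neg
    have hu : Tendsto (fun n : ℕ => Real.exp ((n : ℝ) ^ 2 * β' n)) atTop (𝓝 1) := by
      simpa [Function.comp_def] using (Real.continuous_exp.tendsto _).comp h2'
    exact tendsto_of_tendsto_of_tendsto_of_le_of_le' hl hu (key.mono fun _ hn => hn.1)
      (key.mono fun _ hn => hn.2)
  · intro h1 h2
    have h1' : Tendsto (fun n : ℕ => (n : ℝ) * β' n) atTop (𝓝 0) :=
      h1.congr fun n => by rw [div_div_eq_mul_div, div_one, mul_comm]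
    have h2' : Tendsto (fun n : ℕ => (n : ℝ) ^ 2 * β' n) atTop atTop := by
      have hp : Tendsto (fun n : ℕ => 1 / (n : ℝ) ^ 2 / β' n) atTop (𝓝[>] 0) := by
        refine tendsto_nhdsWithin_iff.2 ⟨h2, ?_⟩
        filter_upwards [eventually_gt_atTop 0] with n hn
        have := hβ' n
        exact Set.mem_Ioi.2 (by positivity)
      refine hp.inv_tendsto_nhdsGT_zero.congr fun n => ?_
      simp [mul_comm]
    -- The exponent left over is `-n(n-1)β'/32`, and `n(n-1) ≥ n²/2` for `n ≥ 2` gives the constant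
    -- `64`.
    have hexp : Tendsto (fun n : ℕ => Real.exp (-((n : ℝ) ^ 2 * β' n / 64))) atTop (𝓝 0) :=
      Real.tendsto_exp_neg_atTop_nhds_zero.comp (h2'.atTop_div_const (by norm_num))
    refine tendsto_of_tendsto_of_tendsto_of_le_of_le' tendsto_const_nhds hexp
      (Eventually.of_forall fun n => div_nonneg (partitionFunction_pos n (hβ' n).le).le
        (partitionFunction_pos n (hβ n)).le) ?_
    filter_upwards [h1'.eventually_le_const hδ, eventually_ge_atTop 2, hsmall] with n hn hn2 hs
    have hn1 : (2 : ℝ) ≤ n := by exact_mod_cast hn2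
    have hb' := hβ' n
    refine (h n (β n) (β' n) (by omega) (hβ n) (by linarith) hn).2.trans (Real.exp_le_exp.2 ?_)
    have hnn : (0 : ℝ) ≤ n * (n - 1) := mul_nonneg (by linarith) (by linarith)
    have hnb : (n : ℝ) ^ 2 / 2 * β' n ≤ n * (n - 1) * β' n :=
      mul_le_mul_of_nonneg_right (by nlinarith) hb'.le
    have hnb1 : n * (n - 1) * β n ≤ n * (n - 1) * (β' n / 16) :=
      mul_le_mul_of_nonneg_left hs hnn
    linarith
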